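/- Let $\phi$ be a pair potential, let $F>0$, let $\phi$ be twice continuously differentiable near $F$ and near $2F$, and put $\phi''_F=\phi''(F)$, $\phi''_{2F}=\phi''(2F)$ and $A_F=\phi''_F+4\phi''_{2F}$. Assume $A_F>0$ and $\phi''_{2F}\neq 0$. For $N\ge 1$ let $\varepsilon=1/N$ and $\mathcal U=\{u\in\mathbb R^{2N+1}: u_{-N}=u_N=0\}$, with components indexed by $-N,\dots,N$. For $1\le p<\infty$ put $\|u\|_{\mathcal U^{1,p}}=\big(\varepsilon\sum_{\ell=-N+1}^{N}|u'_\ell|^p\big)^{1/p}$, where $u'_\ell=\varepsilon^{-1}(u_\ell-u_{\ell-1})$, and for linear $A:\mathcal U\to\mathcal U$ let $\|A\|_{\mathcal U^{1,p}}=\sup_{u\ne0}\|Au\|_{\mathcal U^{1,p}}/\|u\|_{\mathcal U^{1,p}}$. For $-N<j<N$ and $v\in\mathcal U$ define $$(L^{\rm qcl}v)_j=A_F\,\frac{-v_{j+1}+2v_j-v_{j-1}}{\varepsilon^2},$$ $$(L^{\rm a}v)_j=\phi''_F\,\frac{-v_{j+1}+2v_j-v_{j-1}}{\varepsilon^2}+\phi''_{2F}\,\frac{-v_{j+2}+2v_j-v_{j-2}}{\varepsilon^2}\qquad(|j|\le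 N-2),$$ and, for $2\le K\le N/2$, $(L^{\rm qcf}v)_j=(L^{\rm a}v)_j$ if $|j|\le K$ and $(L^{\rm qcf}v)_j=(L^{\rm qcl}v)_j$ if $K<|j|<N$. These are regarded as operators on $\mathcal U$ (with zero boundary values); $L^{\rm qcl}$ is invertible. For $\alpha>0$ let $G_{\rm qcl}=I-\alpha(L^{\rm qcl})^{-1}L^{\rm qcf}$. Then for every $p\in[1,\infty)$ and every $\alpha>0$ we have $\|G_{\rm qcl}\|_{\mathcal U^{1,p}}\sim N^{1/p}$ as $N\to\infty$, uniformly in $K$: there are constants $c,C>0$ and $N_0\in\mathbb N$, depending only on $\phi$, $F$, $p$ and $\alpha$, such that $$c\,N^{1/p}\le\|G_{\rm qcl}\|_{\mathcal U^{1,p}}\le C\,N^{1/p}\qquad\text{for all } N\ge N_0\text{ and all } K\in\mathbb N \text{ with } 2\le K\le N/2 .$$ In particular there is no uniform contraction in these spaces: for every $q\in\mathbb R$ there is $N_1$ such that $\|G_{\rm qcl}\|_{\mathcal U^{1,p}}>q$ for all $N\ge N_1$ and all $2\le K\le N/2$. -/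

import Mathlib

open scoped ENNReal

noncomputable section

namespace QC

/-- The lattice spacing `ε = 1 / N`. -/
def eps (N : ℕ) : ℝ := 1 / (N : ℝ)

/-- The space of admissible displacements `(u_{-N}, …, u_N)` with `u_{-N} = u_N = 0`.
A displacement is extended by zero to all of `ℤ`, so that the sites that can carry a nonzero
value are exactly `-N+1, …, N-1`. -/
def Us (N : ℕ) : Submodule ℝ (ℤ → ℝ) where
  carrier := {v | ∀ j : ℤ, (N : ℤ) ≤ |j| → v j = 0}
  add_mem' := by
    intro a b ha hb j hj
    simp [ha j hj, hb j hj]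
  zero_mem' := by
    intro j _
    rfl
  smul_mem' := by
    intro c a ha j hj
    simp [ha j hj]

/-- The backward difference quotient `v'_ℓ = ε⁻¹ (v_ℓ - v_{ℓ-1})`. -/
def diffQ (N : ℕ) (v : ℤ → ℝ) (l : ℤ) : ℝ := (v l - v (l - 1)) / eps N

/-- The `ℓ^p_ε` norm `(ε ∑_{ℓ=-N+1}^{N} |w_ℓ|^p)^{1/p}`, `1 ≤ p < ∞`. -/
def lpNorm (N : ℕ) (p : ℝ) (w : ℤ → ℝ) : ℝ :=
  (eps N * ∑ l ∈ Finset.Icc (-(N : ℤ) + 1) (N : ℤ), |w l| ^ p) ^ (1 / p)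

/-- The `U^{1,p}` norm of a displacement. -/
def normU1 (N : ℕ) (p : ℝ) (v : Us N) : ℝ := lpNorm N p (diffQ N v)

/-- The operator norm of `A` on `U^{1,p}`: the supremum of `‖A v‖ / ‖v‖` over `v ≠ 0`, taken in
`[0, ∞]`. -/
def opNormU1 (N : ℕ) (p : ℝ) (A : Module.End ℝ (Us N)) : ℝ≥0∞ :=
  ⨆ (v : Us N) (_ : v ≠ 0), ENNReal.ofReal (normU1 N p (A v) / normU1 N p v)

/-- `ε⁻² (-v_{j+m} + 2 v_j - v_{j-m})`. -/
def negSecondDiff (N : ℕ) (m : ℤ) (v : ℤ → ℝ) (j : ℤ) : ℝ :=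
  (-v (j + m) + 2 * v j - v (j - m)) / eps N ^ 2

/-- `(L^a v)_j`, the linearized atomistic operator; `a = φ''(F)` and `b = φ''(2F)`. -/
def atomistic (a b : ℝ) (N : ℕ) (v : ℤ → ℝ) (j : ℤ) : ℝ :=
  a * negSecondDiff N 1 v j + b * negSecondDiff N 2 v j

/-- `(L^{qcl} v)_j`, where `L^{qcl} = A_F L` with `A_F = a + 4 b` and `L` the discrete
Laplacian. -/
def localQC (a b : ℝ) (N : ℕ) (v : ℤ → ℝ) (j : ℤ) : ℝ :=
  (a + 4 * b) * negSecondDiff N 1 v j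

/-- The linear operator `L^{qcl} : U → U`; the equations are posed at `j = -N+1, …, N-1`. -/
def Lqcl (a b : ℝ) (N : ℕ) : Module.End ℝ (Us N) where
  toFun v := ⟨fun j => if |j| < (N : ℤ) then localQC a b N v j else 0, by
    intro j hj
    simp [not_lt.mpr hj]⟩
  map_add' v w := by
    ext j
    by_cases h : |j| < (N : ℤ)
    · simp [h, localQC, negSecondDiff]
      ring
    · simp [h]
  map_smul' c v := by
    ext j
    by_cases h : |j| < (N : ℤ)
    · simp [h, localQC, negSecondDiff]
      ring
    · simp [h]

/-- The linear operator `L^{qcf} : U → U`: atomistic in the region `{-K, …, K}` and local QC in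
the rest of `{-N+1, …, N-1}`. -/
def Lqcf (a b : ℝ) (N K : ℕ) : Module.End ℝ (Us N) where
  toFun v := ⟨fun j => if |j| < (N : ℤ) then
      (if |j| ≤ (K : ℤ) then atomistic a b N v j else localQC a b N v j) else 0, by
    intro j hj
    simp [not_lt.mpr hj]⟩
  map_add' v w := by
    ext j
    by_cases h : |j| < (N : ℤ)
    · by_cases h' : |j| ≤ (K : ℤ)
      · simp [h, h', atomistic, negSecondDiff]
        ring
      · simp [h, h', localQC, negSecondDiff]
        ring
    · simp [h]
  map_smul' c v := by
    ext j
    by_cases h : |j| < (N : ℤ)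
    · by_cases h' : |j| ≤ (K : ℤ)
      · simp [h, h', atomistic, negSecondDiff]
        ring
      · simp [h, h', localQC, negSecondDiff]
        ring
    · simp [h]

/-- The iteration matrix `G = I - α (L^{qcl})⁻¹ L^{qcf}`. Here `Ring.inverse` is the two-sided
inverse in the endomorphism ring, see `isUnit_Lqcl`. -/
def Gqcl (a b α : ℝ) (N K : ℕ) : Module.End ℝ (Us N) :=
  1 - α • (Ring.inverse (Lqcl a b N) * Lqcf a b N K)

instance (N : ℕ) : FiniteDimensional ℝ (Us N) := by
  let f : Us N →ₗ[ℝ] (Finset.Icc (-(N : ℤ)) (N : ℤ) → ℝ) :=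
    { toFun := fun v j => (v : ℤ → ℝ) j
      map_add' := fun _ _ => rfl
      map_smul' := fun _ _ => rfl }
  refine FiniteDimensional.of_injective f ?_
  intro v w h
  ext j
  by_cases hj : j ∈ Finset.Icc (-(N : ℤ)) (N : ℤ)
  · exact congrFun h ⟨j, hj⟩
  · have : (N : ℤ) ≤ |j| := by
      rw [Finset.mem_Icc] at hj
      rw [le_abs]
      omega
    rw [v.2 j this, w.2 j this]

/-- The preconditioner `L^{qcl}` is invertible when `A_F ≠ 0`. -/
theorem isUnit_Lqcl {a b : ℝ} (hA : a + 4 * b ≠ 0) {N : ℕ} (hN : 1 ≤ N) :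
    IsUnit (Lqcl a b N) := by
  have hinj : Function.Injective (Lqcl a b N) := by
    rw [← LinearMap.ker_eq_bot, LinearMap.ker_eq_bot']
    intro v hv
    have heps : eps N ≠ 0 := by
      have : (N : ℝ) ≠ 0 := by exact_mod_cast (by omega : N ≠ 0)
      simp [eps, this]
    have hrec : ∀ j : ℤ, |j| < (N : ℤ) →
        (v : ℤ → ℝ) (j + 1) = 2 * (v : ℤ → ℝ) j - (v : ℤ → ℝ) (j - 1) := by
      intro j hj
      have h1 : (Lqcl a b N v : ℤ → ℝ) j = 0 := by rw [hv]; rfl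
      have h2 : (a + 4 * b) * negSecondDiff N 1 v j = 0 := by
        simpa [Lqcl, hj, localQC] using h1
      have h3 := (mul_eq_zero.mp h2).resolve_left hA
      unfold negSecondDiff at h3
      have h4 := (div_eq_zero_iff.mp h3).resolve_right (pow_ne_zero 2 heps)
      linarith
    have h0 : (v : ℤ → ℝ) (-(N : ℤ)) = 0 := v.2 _ (by simp)
    have hN0 : (v : ℤ → ℝ) (N : ℤ) = 0 := v.2 _ (by simp)
    set s := (v : ℤ → ℝ) (-(N : ℤ) + 1) with hs
    have key : ∀ k : ℕ, k + 1 ≤ 2 * N →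
        (v : ℤ → ℝ) (-(N : ℤ) + k) = k * s ∧
          (v : ℤ → ℝ) (-(N : ℤ) + k + 1) = (k + 1) * s := by
      intro k
      induction k with
      | zero =>
        intro _
        simp [h0, hs]
      | succ k ih =>
        intro hk
        obtain ⟨h1, h2⟩ := ih (by omega)
        have hr := hrec (-(N : ℤ) + k + 1) (by rw [abs_lt]; omega)
        rw [h2, add_sub_cancel_right, h1] at hr
        have e : (-(N : ℤ) + ((k + 1 : ℕ) : ℤ)) = -(N : ℤ) + k + 1 := by push_cast; ring
        rw [e]
        refine ⟨by rw [h2]; push_cast; ring, by rw [hr]; push_cast; ring⟩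
    have hs0 : s = 0 := by
      have h := (key (2 * N - 1) (by omega)).2
      have e : (-(N : ℤ) + ((2 * N - 1 : ℕ) : ℤ) + 1) = N := by omega
      rw [e, hN0] at h
      have hp : (0 : ℝ) < ((2 * N - 1 : ℕ) : ℝ) + 1 := by positivity
      rcases mul_eq_zero.mp h.symm with h' | h'
      · exact absurd h' hp.ne'
      · exact h'
    ext j
    by_cases hj : |j| < (N : ℤ)
    · rw [abs_lt] at hj
      have h := (key (j + N).toNat (by omega)).1
      have e : (-(N : ℤ) + ((j + N).toNat : ℤ)) = j := by omega
      rw [e, hs0, mul_zero] at h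
      exact h
    · exact v.2 j (not_lt.mp hj)
  rw [Module.End.isUnit_iff]
  exact ⟨hinj, LinearMap.injective_iff_surjective.mp hinj⟩

end QC

end

/-! Write `r = v'`, `A = a + 4 b` and `D²` for the second difference. Both operators have divergence
form: `(L^qcl v)_j = -(A / ε) (r_{j+1} - r_j)`, and `(L^qcf v)_j` has the extra term
`-(b / ε) (s_{j+1} - s_j)`, where `s_l = (D² r)` at the projection of `l` to `{-K, …, K + 1}`. Hence
`(G v)' = (1 - α) r - (α b / A) s + const`, the constant being fixed by `∑ (G v)' = 0`.

Upper bound: mean zero controls `‖(G v)'‖_∞` by its oscillation, hence by `‖r‖_∞`, and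
`‖r‖_∞ ≤ N^{1/p} ‖r‖_p`. Lower bound: let `v` be the bump with strains `±1` around the site `K + 2`,
whose norm is `(2 / N)^{1/p}`. Then `r = 0` and `s = 1` for `l > K + 3`, while `r = s = 0` for
`l ≤ -K`, so that on one of these two long intervals `(G v)'` is a constant of modulus at least
`|α b / A| / 2`. -/

namespace QC

section Finset

variable {ι : Type*} {s t : Finset ι} {f : ι → ℝ} {B p : ℝ}

theorem abs_le_of_sum_eq_zero_of_abs_sub_le (hf : ∑ i ∈ s, f i = 0) {i : ι} (hi : i ∈ s)
    (hB : ∀ j ∈ s, |f i - f j| ≤ B) : |f i| ≤ B := by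
  have hcard : (0 : ℝ) < s.card := by exact_mod_cast Finset.card_pos.mpr ⟨i, hi⟩
  have hsum : ∑ j ∈ s, (f i - f j) = s.card * f i := by
    rw [Finset.sum_sub_distrib, hf, Finset.sum_const, nsmul_eq_mul, sub_zero]
  refine le_of_mul_le_mul_left ?_ hcard
  calc s.card * |f i| = |∑ j ∈ s, (f i - f j)| := by rw [hsum, abs_mul, Nat.abs_cast]
    _ ≤ ∑ j ∈ s, |f i - f j| := Finset.abs_sum_le_sum_abs _ _
    _ ≤ s.card • B := Finset.sum_le_card_nsmul _ _ _ hB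
    _ = s.card * B := nsmul_eq_mul _ _

theorem rpow_sum_abs_rpow_le_of_abs_le (hp : 0 < p) (hB₀ : 0 ≤ B) (hB : ∀ i ∈ s, |f i| ≤ B) :
    (∑ i ∈ s, |f i| ^ p) ^ (1 / p) ≤ (s.card : ℝ) ^ (1 / p) * B := by
  calc (∑ i ∈ s, |f i| ^ p) ^ (1 / p) ≤ (s.card • B ^ p) ^ (1 / p) := by
        gcongr
        exact Finset.sum_le_card_nsmul _ _ _ fun i hi =>
          Real.rpow_le_rpow (abs_nonneg _) (hB i hi) hp.le
    _ = (s.card : ℝ) ^ (1 / p) * B := by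
        rw [nsmul_eq_mul, Real.mul_rpow (by positivity) (by positivity), one_div,
          Real.rpow_rpow_inv hB₀ hp.ne']

theorem le_rpow_sum_abs_rpow_of_le_abs (hp : 0 < p) (hB₀ : 0 ≤ B) (hts : t ⊆ s)
    (hB : ∀ i ∈ t, B ≤ |f i|) :
    (t.card : ℝ) ^ (1 / p) * B ≤ (∑ i ∈ s, |f i| ^ p) ^ (1 / p) := by
  calc (t.card : ℝ) ^ (1 / p) * B = (t.card • B ^ p) ^ (1 / p) := by
        rw [nsmul_eq_mul, Real.mul_rpow (by positivity) (by positivity), one_div,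
          Real.rpow_rpow_inv hB₀ hp.ne']
    _ ≤ (∑ i ∈ t, |f i| ^ p) ^ (1 / p) := by
        gcongr
        exact Finset.card_nsmul_le_sum _ _ _ fun i hi => Real.rpow_le_rpow hB₀ (hB i hi) hp.le
    _ ≤ (∑ i ∈ s, |f i| ^ p) ^ (1 / p) := by
        gcongr

end Finset

theorem eq_of_forall_add_one_eq {β : Type*} {f : ℤ → β} {s : Set ℤ} (hs : s.OrdConnected)
    (hf : ∀ j ∈ s, j + 1 ∈ s → f (j + 1) = f j) {i j : ℤ} (hi : i ∈ s) (hj : j ∈ s) :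
    f i = f j := by
  wlog hij : i ≤ j generalizing i j
  · exact (this hj hi (le_of_not_ge hij)).symm
  induction j, hij using Int.leInduction with
  | base => rfl
  | succ k hik ih =>
    have hk : k ∈ s := hs.out hi hj ⟨hik, by omega⟩
    rw [hf k hk hj, ih hk]

theorem sum_Icc_sub_sub_one {G : Type*} [AddCommGroup G] (f : ℤ → G) {m n : ℤ} (hmn : m ≤ n) :
    ∑ l ∈ Finset.Icc (m + 1) n, (f l - f (l - 1)) = f n - f m := by
  induction n, hmn using Int.leInduction with
  | base => simp
  | succ k hmk ih =>
    rw [← Finset.insert_Icc_right_eq_Icc_add_one (by omega), Finset.sum_insert (by simp), ih,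
      add_sub_cancel_right, sub_add_sub_cancel]

theorem eventually_ofReal_lt_ofReal_mul_rpow {c s : ℝ} (hc : 0 < c) (hs : 0 < s) (q : ℝ) :
    ∀ᶠ N : ℕ in Filter.atTop, ENNReal.ofReal q < ENNReal.ofReal (c * (N : ℝ) ^ s) :=
  (ENNReal.tendsto_ofReal_atTop.comp <|
    ((tendsto_rpow_atTop hs).comp tendsto_natCast_atTop_atTop).const_mul_atTop hc)
    |>.eventually_const_lt ENNReal.ofReal_lt_top

variable {N K : ℕ}

theorem eps_pos (hN : N ≠ 0) : 0 < eps N :=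
  one_div_pos.mpr (by exact_mod_cast Nat.pos_of_ne_zero hN)

/-- The bonds `-N + 1, …, N`, which index the strains of a displacement; the bond `l` joins the
sites `l - 1` and `l`. -/
noncomputable def bonds (N : ℕ) : Finset ℤ := Finset.Icc (-(N : ℤ) + 1) N

theorem mem_bonds {l : ℤ} : l ∈ bonds N ↔ -(N : ℤ) < l ∧ l ≤ N := Finset.mem_Icc

theorem card_bonds (N : ℕ) : (bonds N).card = 2 * N := by
  rw [bonds, Int.card_Icc]
  omega

theorem sum_diffQ (v : Us N) : ∑ l ∈ bonds N, diffQ N v l = 0 := by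
  simp only [diffQ, bonds, ← Finset.sum_div]
  rw [sum_Icc_sub_sub_one (v : ℤ → ℝ) (by omega), v.2 N (by simp), v.2 (-N) (by simp), sub_zero,
    zero_div]

theorem diffQ_eq_zero_of_notMem_bonds (v : Us N) {l : ℤ} (hl : l ∉ bonds N) :
    diffQ N v l = 0 := by
  rw [mem_bonds] at hl
  rw [diffQ, v.2 l (by rw [le_abs]; omega), v.2 (l - 1) (by rw [le_abs]; omega), sub_zero,
    zero_div]

section Norm

variable {p : ℝ}

theorem lpNorm_nonneg (N : ℕ) (p : ℝ) (w : ℤ → ℝ) : 0 ≤ lpNorm N p w := by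
  unfold lpNorm eps
  positivity

theorem rpow_mul_lpNorm (hN : N ≠ 0) (p : ℝ) (w : ℤ → ℝ) :
    (N : ℝ) ^ (1 / p) * lpNorm N p w = (∑ l ∈ bonds N, |w l| ^ p) ^ (1 / p) := by
  rw [lpNorm, ← Real.mul_rpow (by positivity) (by unfold eps; positivity), eps, ← mul_assoc,
    mul_one_div_cancel (by exact_mod_cast hN), one_mul, bonds]

theorem abs_diffQ_le_rpow_mul_normU1 (hN : N ≠ 0) (hp : 0 < p) (v : Us N) (l : ℤ) :
    |diffQ N v l| ≤ (N : ℝ) ^ (1 / p) * normU1 N p v := by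
  by_cases hl : l ∈ bonds N
  · rw [normU1, rpow_mul_lpNorm hN]
    simpa using
      le_rpow_sum_abs_rpow_of_le_abs (f := diffQ N v) (B := |diffQ N v l|) hp (abs_nonneg _)
        (Finset.singleton_subset_iff.mpr hl) (by simp)
  · rw [diffQ_eq_zero_of_notMem_bonds v hl, abs_zero]
    exact mul_nonneg (by positivity) (lpNorm_nonneg _ _ _)

theorem normU1_le_of_abs_diffQ_sub_le (hN : N ≠ 0) (hp : 0 < p) (w : Us N) {B : ℝ} (hB₀ : 0 ≤ B)
    (hB : ∀ l ∈ bonds N, ∀ m ∈ bonds N, |diffQ N w l - diffQ N w m| ≤ B) :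
    normU1 N p w ≤ 2 ^ (1 / p) * B := by
  have hN₀ : (0 : ℝ) < N := by exact_mod_cast Nat.pos_of_ne_zero hN
  have hbound := rpow_sum_abs_rpow_le_of_abs_le hp hB₀ fun l hl =>
    abs_le_of_sum_eq_zero_of_abs_sub_le (sum_diffQ w) hl (hB l hl)
  rw [← rpow_mul_lpNorm hN, card_bonds, Nat.cast_mul, Nat.cast_two, mul_comm (2 : ℝ),
    Real.mul_rpow hN₀.le zero_le_two, mul_assoc] at hbound
  exact le_of_mul_le_mul_left hbound (by positivity)

end Norm

/-- The second difference of a sequence of strains, without the factor `ε⁻²` and with the sign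
opposite to that of `negSecondDiff`. -/
def secondDiff {R : Type*} [Ring R] (r : ℤ → R) (l : ℤ) : R := r (l + 1) - 2 * r l + r (l - 1)

theorem abs_secondDiff_le {R : Type*} [CommRing R] [LinearOrder R] [IsStrictOrderedRing R]
    {r : ℤ → R} {M : R} (hr : ∀ l, |r l| ≤ M) (l : ℤ) : |secondDiff r l| ≤ 4 * M := by
  have hright := abs_le.mp (hr (l + 1))
  have hmid := abs_le.mp (hr l)
  have hleft := abs_le.mp (hr (l - 1))
  rw [secondDiff, abs_le]
  constructor <;> linarith

/-- The projection of `l` to `{-K, …, K + 1}`, the bonds with an endpoint in the atomistic region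
`{-K, …, K}`. -/
def clamp (K : ℕ) (l : ℤ) : ℤ := max (-(K : ℤ)) (min l (K + 1))

section StrainForm

variable {a b α : ℝ}

theorem negSecondDiff_one_eq (hN : N ≠ 0) (v : ℤ → ℝ) (j : ℤ) :
    negSecondDiff N 1 v j = -(diffQ N v (j + 1) - diffQ N v j) / eps N := by
  have hε := (eps_pos hN).ne'
  simp only [negSecondDiff, diffQ, add_sub_cancel_right]
  field_simp
  ring

theorem negSecondDiff_two_eq (hN : N ≠ 0) (v : ℤ → ℝ) (j : ℤ) :
    negSecondDiff N 2 v j =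
      4 * negSecondDiff N 1 v j -
        (secondDiff (diffQ N v) (j + 1) - secondDiff (diffQ N v) j) / eps N := by
  have hε := (eps_pos hN).ne'
  have h₁ : j + 1 + 1 = j + 2 := by ring
  have h₂ : j + 2 - 1 = j + 1 := by ring
  have h₃ : j - 1 - 1 = j - 2 := by ring
  simp only [negSecondDiff, secondDiff, diffQ, add_sub_cancel_right, h₁, h₂, h₃]
  field_simp
  ring

theorem Lqcl_apply (hN : N ≠ 0) (v : Us N) {j : ℤ} (hj : |j| < (N : ℤ)) :
    (Lqcl a b N v : ℤ → ℝ) j = -((a + 4 * b) * (diffQ N v (j + 1) - diffQ N v j)) / eps N := by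
  simp only [Lqcl, LinearMap.coe_mk, AddHom.coe_mk, hj, if_true, localQC,
    negSecondDiff_one_eq hN]
  ring

theorem Lqcf_apply (hN : N ≠ 0) (v : Us N) {j : ℤ} (hj : |j| < (N : ℤ)) :
    (Lqcf a b N K v : ℤ → ℝ) j = (Lqcl a b N v : ℤ → ℝ) j -
      b * (secondDiff (diffQ N v) (clamp K (j + 1)) - secondDiff (diffQ N v) (clamp K j)) /
        eps N := by
  by_cases hK : |j| ≤ (K : ℤ)
  · have hj_clamp : clamp K j = j ∧ clamp K (j + 1) = j + 1 := by
      rw [abs_le] at hK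
      unfold clamp
      omega
    simp only [Lqcf, Lqcl, LinearMap.coe_mk, AddHom.coe_mk, hj, hK, if_true, atomistic, localQC,
      negSecondDiff_two_eq hN, hj_clamp]
    ring
  · have hj_clamp : clamp K (j + 1) = clamp K j := by
      rw [abs_le] at hK
      unfold clamp
      omega
    simp [Lqcf, Lqcl, hj, hK, hj_clamp]

theorem Lqcl_Gqcl (hA : a + 4 * b ≠ 0) (hN : N ≠ 0) (v : Us N) :
    Lqcl a b N (Gqcl a b α N K v) = Lqcl a b N v - α • Lqcf a b N K v := by
  have hinv : Lqcl a b N (Ring.inverse (Lqcl a b N) (Lqcf a b N K v)) = Lqcf a b N K v :=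
    LinearMap.congr_fun
      (Ring.mul_inverse_cancel _ (isUnit_Lqcl hA (Nat.one_le_iff_ne_zero.mpr hN))) _
  have hG : Gqcl a b α N K v = v - α • Ring.inverse (Lqcl a b N) (Lqcf a b N K v) := rfl
  rw [hG, map_sub, map_smul, hinv]

theorem diffQ_Gqcl_add_one_sub (hA : a + 4 * b ≠ 0) (hN : N ≠ 0) (v : Us N) {j : ℤ}
    (hj : |j| < (N : ℤ)) :
    diffQ N (Gqcl a b α N K v) (j + 1) - diffQ N (Gqcl a b α N K v) j =
      (1 - α) * (diffQ N v (j + 1) - diffQ N v j) -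
        α * b / (a + 4 * b) *
          (secondDiff (diffQ N v) (clamp K (j + 1)) - secondDiff (diffQ N v) (clamp K j)) := by
  have hε := (eps_pos hN).ne'
  have hsite : (Lqcl a b N (Gqcl a b α N K v) : ℤ → ℝ) j =
      (Lqcl a b N v : ℤ → ℝ) j - α * (Lqcf a b N K v : ℤ → ℝ) j := by
    rw [Lqcl_Gqcl hA hN]
    rfl
  rw [Lqcf_apply hN v hj, Lqcl_apply hN v hj, Lqcl_apply hN _ hj] at hsite
  field_simp at hsite ⊢
  linear_combination -hsite

theorem exists_diffQ_Gqcl_eq_add_const (hA : a + 4 * b ≠ 0) (hN : N ≠ 0) (v : Us N) :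
    ∃ c : ℝ, ∀ l ∈ bonds N, diffQ N (Gqcl a b α N K v) l =
      (1 - α) * diffQ N v l - α * b / (a + 4 * b) * secondDiff (diffQ N v) (clamp K l) + c := by
  let T : ℤ → ℝ := fun l => diffQ N (Gqcl a b α N K v) l -
    ((1 - α) * diffQ N v l - α * b / (a + 4 * b) * secondDiff (diffQ N v) (clamp K l))
  have hT_step : ∀ j ∈ Set.Icc (-(N : ℤ) + 1) N, j + 1 ∈ Set.Icc (-(N : ℤ) + 1) N →
      T (j + 1) = T j := fun j hj hj' => by
    rw [Set.mem_Icc] at hj hj'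
    linear_combination
      diffQ_Gqcl_add_one_sub (K := K) (α := α) hA hN v (j := j) (by rw [abs_lt]; omega)
  refine ⟨T N, fun l hl => ?_⟩
  rw [← eq_of_forall_add_one_eq Set.ordConnected_Icc hT_step (Finset.mem_Icc.mp hl)
    ⟨by omega, le_rfl⟩]
  ring

end StrainForm

section UpperBound

variable {a b α p : ℝ}

theorem abs_diffQ_Gqcl_sub_le (hA : a + 4 * b ≠ 0) (hN : N ≠ 0) (v : Us N) {M : ℝ}
    (hM : ∀ l, |diffQ N v l| ≤ M) {l m : ℤ} (hl : l ∈ bonds N) (hm : m ∈ bonds N) :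
    |diffQ N (Gqcl a b α N K v) l - diffQ N (Gqcl a b α N K v) m| ≤
      (2 * |1 - α| + 8 * |α * b / (a + 4 * b)|) * M := by
  obtain ⟨c, hc⟩ := exists_diffQ_Gqcl_eq_add_const (K := K) (α := α) hA hN v
  set r := diffQ N v
  set γ := α * b / (a + 4 * b)
  have hr : |r l - r m| ≤ 2 * M := by linarith [abs_sub (r l) (r m), hM l, hM m]
  have hs : |secondDiff r (clamp K l) - secondDiff r (clamp K m)| ≤ 8 * M := by
    linarith [abs_sub (secondDiff r (clamp K l)) (secondDiff r (clamp K m)),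
      abs_secondDiff_le hM (clamp K l), abs_secondDiff_le hM (clamp K m)]
  calc |diffQ N (Gqcl a b α N K v) l - diffQ N (Gqcl a b α N K v) m|
      = |(1 - α) * (r l - r m) -
          γ * (secondDiff r (clamp K l) - secondDiff r (clamp K m))| := by
        rw [hc l hl, hc m hm]
        ring_nf
    _ ≤ |1 - α| * |r l - r m| +
          |γ| * |secondDiff r (clamp K l) - secondDiff r (clamp K m)| := by
        simpa only [abs_mul] using
          abs_sub ((1 - α) * (r l - r m))
            (γ * (secondDiff r (clamp K l) - secondDiff r (clamp K m)))
    _ ≤ |1 - α| * (2 * M) + |γ| * (8 * M) := by gcongr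
    _ = (2 * |1 - α| + 8 * |γ|) * M := by ring

theorem opNormU1_Gqcl_le (hA : a + 4 * b ≠ 0) (hp : 0 < p) (hN : N ≠ 0) :
    opNormU1 N p (Gqcl a b α N K) ≤
      ENNReal.ofReal
        (2 ^ (1 / p) * (2 * |1 - α| + 8 * |α * b / (a + 4 * b)|) * (N : ℝ) ^ (1 / p)) := by
  refine iSup₂_le fun v _ => ENNReal.ofReal_le_ofReal ?_
  have hv : 0 ≤ normU1 N p v := lpNorm_nonneg _ _ _
  refine div_le_of_le_mul₀ hv (by positivity) ?_
  rw [mul_assoc, mul_assoc]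
  exact normU1_le_of_abs_diffQ_sub_le hN hp _ (by positivity) fun _ hl _ hm =>
    abs_diffQ_Gqcl_sub_le hA hN v (abs_diffQ_le_rpow_mul_normU1 hN hp v) hl hm

end UpperBound

section LowerBound

variable {a b α p : ℝ}

/-- The displacement with value `ε` at the site `k` and zero elsewhere, normalised to have strains
`±1`. -/
noncomputable def bump (N : ℕ) (k : ℤ) (hk : |k| < (N : ℤ)) : Us N :=
  ⟨Pi.single k (eps N), fun j hj => by
    rw [Pi.single_apply, if_neg]
    rintro rfl
    omega⟩

theorem diffQ_bump {k : ℤ} (hk : |k| < (N : ℤ)) (l : ℤ) :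
    diffQ N (bump N k hk) l = if l = k then 1 else if l = k + 1 then -1 else 0 := by
  have hε := (eps_pos (N := N) (by have := abs_nonneg k; omega)).ne'
  have hl : l - 1 = k ↔ l = k + 1 := by omega
  simp only [diffQ, bump, Pi.single_apply, hl]
  split_ifs with h₁ h₂
  · omega
  all_goals simp [hε]

theorem diffQ_bump_eq_zero {k : ℤ} (hk : |k| < (N : ℤ)) {l : ℤ} (hl : l < k ∨ k + 1 < l) :
    diffQ N (bump N k hk) l = 0 := by
  rw [diffQ_bump, if_neg (by omega), if_neg (by omega)]

theorem bump_ne_zero {k : ℤ} (hk : |k| < (N : ℤ)) : bump N k hk ≠ 0 := fun h => by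
  simpa [h, diffQ] using diffQ_bump hk k

theorem rpow_mul_normU1_bump (hp : 0 < p) {k : ℤ} (hk : |k| < (N : ℤ)) :
    (N : ℝ) ^ (1 / p) * normU1 N p (bump N k hk) = 2 ^ (1 / p) := by
  have hk' := abs_lt.mp hk
  rw [normU1, rpow_mul_lpNorm (by omega), ← Finset.sum_subset (s₁ := {k, k + 1}),
    Finset.sum_pair (by omega)]
  · simp only [diffQ_bump]
    norm_num
  · simp only [Finset.insert_subset_iff, Finset.singleton_subset_iff, mem_bonds]
    omega
  · intro l _ hl
    simp only [Finset.mem_insert, Finset.mem_singleton] at hl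
    rw [diffQ_bump_eq_zero hk (by omega), abs_zero, Real.zero_rpow hp.ne']

theorem exists_diffQ_Gqcl_bump (hA : a + 4 * b ≠ 0) (hk : |(K : ℤ) + 2| < N) :
    ∃ c : ℝ,
      (∀ l ∈ Finset.Icc (-(N : ℤ) + 1) (-K),
        diffQ N (Gqcl a b α N K (bump N (K + 2) hk)) l = c) ∧
      ∀ l ∈ Finset.Icc ((K : ℤ) + 4) N,
        diffQ N (Gqcl a b α N K (bump N (K + 2) hk)) l = c - α * b / (a + 4 * b) := by
  have hKN := abs_lt.mp hk
  obtain ⟨c, hc⟩ := exists_diffQ_Gqcl_eq_add_const (K := K) (α := α) hA (by omega)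
    (bump N (K + 2) hk)
  have hleft : secondDiff (diffQ N (bump N (K + 2) hk)) (-K) = 0 := by
    simp only [secondDiff]
    rw [diffQ_bump_eq_zero hk (by omega), diffQ_bump_eq_zero hk (by omega),
      diffQ_bump_eq_zero hk (by omega)]
    ring
  have hright : secondDiff (diffQ N (bump N (K + 2) hk)) (K + 1) = 1 := by
    simp only [secondDiff]
    rw [diffQ_bump, if_pos (by ring), diffQ_bump_eq_zero hk (by omega),
      diffQ_bump_eq_zero hk (by omega)]
    ring
  refine ⟨c, fun l hl => ?_, fun l hl => ?_⟩ <;> rw [Finset.mem_Icc] at hl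
  · have hclamp : clamp K l = -K := by unfold clamp; omega
    rw [hc l (by rw [mem_bonds]; omega), hclamp, hleft, diffQ_bump_eq_zero hk (by omega)]
    ring
  · have hclamp : clamp K l = K + 1 := by unfold clamp; omega
    rw [hc l (by rw [mem_bonds]; omega), hclamp, hright, diffQ_bump_eq_zero hk (by omega)]
    ring

theorem le_rpow_mul_normU1_Gqcl_bump (hA : a + 4 * b ≠ 0) (hp : 0 < p)
    (hk : |(K : ℤ) + 2| < N) :
    ((N : ℝ) - K - 3) ^ (1 / p) * (|α * b / (a + 4 * b)| / 2) ≤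
      (N : ℝ) ^ (1 / p) * normU1 N p (Gqcl a b α N K (bump N (K + 2) hk)) := by
  have hKN := abs_lt.mp hk
  have hKN' : (K : ℝ) + 3 ≤ N := by exact_mod_cast (by omega : K + 3 ≤ N)
  obtain ⟨c, hleft, hright⟩ := exists_diffQ_Gqcl_bump (α := α) hA hk
  set γ := α * b / (a + 4 * b)
  obtain ⟨t, ht, hcard, hγ⟩ : ∃ t ⊆ bonds N, N - K - 3 ≤ t.card ∧
      ∀ l ∈ t, |γ| / 2 ≤ |diffQ N (Gqcl a b α N K (bump N (K + 2) hk)) l| := by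
    rcases le_or_gt (|γ| / 2) |c| with hc | hc
    · refine ⟨Finset.Icc (-(N : ℤ) + 1) (-K), Finset.Icc_subset_Icc le_rfl (by omega), ?_,
        fun l hl => by rwa [hleft l hl]⟩
      rw [Int.card_Icc]
      omega
    · refine ⟨Finset.Icc (K + 4) N, Finset.Icc_subset_Icc (by omega) le_rfl, ?_, fun l hl => ?_⟩
      · rw [Int.card_Icc]
        omega
      · rw [hright l hl]
        linarith [abs_sub_abs_le_abs_sub γ c, abs_sub_comm γ c]
  have hcard' : (N : ℝ) - K - 3 ≤ t.card := by
    have : (N : ℝ) ≤ t.card + K + 3 := by exact_mod_cast (by omega : N ≤ t.card + K + 3)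
    linarith
  rw [normU1, rpow_mul_lpNorm (by omega)]
  refine le_trans ?_ (le_rpow_sum_abs_rpow_of_le_abs hp (by positivity) ht hγ)
  gcongr
  linarith

theorem le_opNormU1_Gqcl (hA : a + 4 * b ≠ 0) (hp : 0 < p) (hKN : K + 3 ≤ N) :
    ENNReal.ofReal ((((N : ℝ) - K - 3) / 2) ^ (1 / p) * (|α * b / (a + 4 * b)| / 2)) ≤
      opNormU1 N p (Gqcl a b α N K) := by
  have hk : |(K : ℤ) + 2| < N := by rw [abs_lt]; omega
  have hN₀ : (0 : ℝ) < N := by exact_mod_cast (by omega : 0 < N)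
  have hKN' : (K : ℝ) + 3 ≤ N := by exact_mod_cast hKN
  refine le_trans (ENNReal.ofReal_le_ofReal ?_)
    (le_iSup₂ (f := fun (v : Us N) (_ : v ≠ 0) =>
      ENNReal.ofReal (normU1 N p (Gqcl a b α N K v) / normU1 N p v)) _ (bump_ne_zero hk))
  have hbump := rpow_mul_normU1_bump hp hk
  rw [Real.div_rpow (by linarith) zero_le_two, div_mul_eq_mul_div,
    ← mul_div_mul_left (normU1 N p _) _ (Real.rpow_pos_of_pos hN₀ (1 / p)).ne', hbump]
  exact div_le_div_of_nonneg_right (le_rpow_mul_normU1_Gqcl_bump hA hp hk) (by positivity)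

theorem le_opNormU1_Gqcl_of_le_mul (hA : a + 4 * b ≠ 0) (hp : 0 < p) {θ : ℝ}
    (hKN : (K : ℝ) ≤ θ * N) (hN : 6 ≤ (1 - θ) * N) :
    ENNReal.ofReal
        (((1 - θ) / 4) ^ (1 / p) * (|α * b / (a + 4 * b)| / 2) * (N : ℝ) ^ (1 / p)) ≤
      opNormU1 N p (Gqcl a b α N K) := by
  have hθ : 0 < 1 - θ := pos_of_mul_pos_left (by linarith) (Nat.cast_nonneg N)
  have hKN' : K + 3 ≤ N := by exact_mod_cast (by linarith : (K : ℝ) + 3 ≤ N)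
  refine le_trans (ENNReal.ofReal_le_ofReal ?_) (le_opNormU1_Gqcl hA hp hKN')
  rw [mul_right_comm, ← Real.mul_rpow (by positivity) (by positivity)]
  gcongr
  linarith

end LowerBound

end QC

theorem mainTheorem6_general {a b α p θ : ℝ} (hA : a + 4 * b ≠ 0) (hb : b ≠ 0) (hα : α ≠ 0)
    (hp : 0 < p) (hθ : θ < 1) :
    (∃ c C : ℝ, 0 < c ∧ 0 < C ∧ ∃ N₀ : ℕ, ∀ N K : ℕ, N₀ ≤ N → (K : ℝ) ≤ θ * N →
      ENNReal.ofReal (c * (N : ℝ) ^ (1 / p)) ≤ QC.opNormU1 N p (QC.Gqcl a b α N K) ∧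
        QC.opNormU1 N p (QC.Gqcl a b α N K) ≤ ENNReal.ofReal (C * (N : ℝ) ^ (1 / p))) ∧
    ∀ q : ℝ, ∃ N₀ : ℕ, ∀ N K : ℕ, N₀ ≤ N → (K : ℝ) ≤ θ * N →
      ENNReal.ofReal q < QC.opNormU1 N p (QC.Gqcl a b α N K) := by
  have hθ' : 0 < 1 - θ := sub_pos.mpr hθ
  have hc : 0 < ((1 - θ) / 4) ^ (1 / p) * (|α * b / (a + 4 * b)| / 2) :=
    mul_pos (by positivity)
      (half_pos (abs_pos.mpr (div_ne_zero (mul_ne_zero hα hb) hA)))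
  have hlarge : ∀ᶠ N : ℕ in Filter.atTop, 6 ≤ (1 - θ) * N :=
    (tendsto_natCast_atTop_atTop.const_mul_atTop hθ').eventually_ge_atTop 6
  refine ⟨⟨_, 2 ^ (1 / p) * (2 * |1 - α| + 8 * |α * b / (a + 4 * b)|), hc, by positivity, ?_⟩,
    fun q => ?_⟩
  · obtain ⟨N₀, hN₀⟩ := Filter.eventually_atTop.mp (hlarge.and (Filter.eventually_ne_atTop 0))
    exact ⟨N₀, fun N K hN hKN =>
      ⟨QC.le_opNormU1_Gqcl_of_le_mul hA hp hKN (hN₀ N hN).1,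
        QC.opNormU1_Gqcl_le hA hp (hN₀ N hN).2⟩⟩
  · obtain ⟨N₀, hN₀⟩ := Filter.eventually_atTop.mp
      (hlarge.and (QC.eventually_ofReal_lt_ofReal_mul_rpow hc (one_div_pos.mpr hp) q))
    exact ⟨N₀, fun N K hN hKN =>
      (hN₀ N hN).2.trans_le (QC.le_opNormU1_Gqcl_of_le_mul hA hp hKN (hN₀ N hN).1)⟩

theorem mainTheorem6 (φ : ℝ → ℝ) (F : ℝ) (hF : 0 < F)
    (hφF : ContDiffAt ℝ 2 φ F) (hφ2F : ContDiffAt ℝ 2 φ (2 * F))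
    (hAF : 0 < iteratedDeriv 2 φ F + 4 * iteratedDeriv 2 φ (2 * F))
    (hne : iteratedDeriv 2 φ (2 * F) ≠ 0)
    (p : ℝ) (hp : 1 ≤ p) (α : ℝ) (hα : 0 < α) :
    (∃ c C : ℝ, 0 < c ∧ 0 < C ∧ ∃ N₀ : ℕ, ∀ N K : ℕ, N₀ ≤ N → 2 ≤ K → (K : ℝ) ≤ (N : ℝ) / 2 →
      ENNReal.ofReal (c * (N : ℝ) ^ (1 / p)) ≤
          QC.opNormU1 N p
            (QC.Gqcl (iteratedDeriv 2 φ F) (iteratedDeriv 2 φ (2 * F)) α N K) ∧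
        QC.opNormU1 N p
            (QC.Gqcl (iteratedDeriv 2 φ F) (iteratedDeriv 2 φ (2 * F)) α N K) ≤
          ENNReal.ofReal (C * (N : ℝ) ^ (1 / p))) ∧
    (∀ q : ℝ, ∃ N₀ : ℕ, ∀ N K : ℕ, N₀ ≤ N → 2 ≤ K → (K : ℝ) ≤ (N : ℝ) / 2 →
      ENNReal.ofReal q <
        QC.opNormU1 N p
          (QC.Gqcl (iteratedDeriv 2 φ F) (iteratedDeriv 2 φ (2 * F)) α N K)) := by
  obtain ⟨⟨c, C, hc, hC, N₀, hbounds⟩, hlarge⟩ := mainTheorem6_general (θ := 1 / 2) hAF.ne' hne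
    hα.ne' (zero_lt_one.trans_le hp) one_half_lt_one
  exact ⟨⟨c, C, hc, hC, N₀, fun N K hN _ hKN => hbounds N K hN (by linarith)⟩,
    fun q => (hlarge q).imp fun _ hq N K hN _ hKN => hq N K hN (by linarith)⟩
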